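/- Let $n \ge k \ge 1$ be integers. The Johnson graph $J(n,k)$ has as vertices all $k$-subsets of $\{1,\dots,n\}$, two of them being adjacent if and only if their intersection has exactly $k-1$ elements. A vertex-cut of a graph $G$ is a set $S$ of vertices such that $G-S$ is disconnected or has an isolated vertex; it is a super vertex-cut if moreover $G-S$ has no isolated vertex. The super-connectivity $\kappa'(G)$ is the minimum cardinality of a super vertex-cut of $G$, with $\kappa'(G)=+\infty$ if $G$ has no super vertex-cut. (The graph without vertices is not regarded as disconnected.) Then $$\kappa'(J(n,k))=\begin{cases} 3(n-3) & \text{if } k=2 \text{ and } n\ge 6,\\ 3(k-1) & \text{if } k\ge 4 \text{ and } n=k+2,\\ (2k-1)(n-k)-k & \text{if } k\ge 3 \text{ and } n\ge k+3,\\ +\infty & \text{otherwise.} \end{cases}$$ -/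

import Mathlib

/-- The Johnson graph `J(n, k)`: its vertices are the `k`-subsets of an `n`-set, and two of them
are adjacent when their intersection has `k - 1` elements. The condition `|u ∩ v| = k - 1` is
written `|u ∩ v| + 1 = k` to avoid truncated subtraction; the two agree for `k ≥ 1`. -/
def johnsonGraph (n k : ℕ) : SimpleGraph {s : Finset (Fin n) // s.card = k} where
  Adj u v := (u.1 ∩ v.1).card + 1 = k
  symm := ⟨fun u v h => by rwa [Finset.inter_comm]⟩
  loopless := ⟨fun u h => by
    rw [Finset.inter_self, u.2] at h
    omega⟩

namespace SimpleGraph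

/-- A set of vertices is a vertex-cut if its deletion results in a disconnected graph or leaves an
isolated vertex. (The graph without vertices is not counted as disconnected, which is why
`Preconnected` and not `Connected` is used.) -/
def IsVertexCut {V : Type*} (G : SimpleGraph V) (S : Set V) : Prop :=
  ¬ (G.induce Sᶜ).Preconnected ∨ ∃ v, (G.induce Sᶜ).IsIsolated v

/-- A super vertex-cut is a vertex-cut whose deletion leaves no isolated vertex. -/
def IsSuperVertexCut {V : Type*} (G : SimpleGraph V) (S : Set V) : Prop :=
  G.IsVertexCut S ∧ ∀ v, ¬ (G.induce Sᶜ).IsIsolated v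

/-- The super-connectivity: the size of a minimum super vertex-cut, and `⊤` if there is none. -/
noncomputable def superConnectivity {V : Type*} (G : SimpleGraph V) : ℕ∞ :=
  ⨅ S ∈ {S : Set V | G.IsSuperVertexCut S}, S.encard

end SimpleGraph

open Finset

/-! A super vertex-cut leaves no isolated vertex, so it must disconnect the graph. Taking one
component as `𝒜` and the remaining vertices as `ℬ` turns it into a separated pair whose members all
have neighbours in their own family; the cut is the complement of `𝒜 ∪ ℬ`. Complementing sets
exchanges `k` and `#E - k`, so the genuine cases are `k = 2` and `3 ≤ k ≤ #E - 3`.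

For `k = 2` the vertices are edges of a complete graph. The two families have disjoint supports of
at least three points each, and the cut contains every pair joining the support of `𝒜` to the rest
of `E` (`JohnsonSuperSep.pair_bound`).

For `3 ≤ k ≤ #E - 3` the optimum is the neighbourhood of an edge, of size `2 * k * (#E - k) - #E`.
Splitting by a coordinate `i` gives separated pairs in two smaller Johnson graphs. If `i` varies on
both families, vertex connectivity of these graphs already gives that bound
(`JohnsonSep.constant_of_card_cut_lt`). Otherwise every coordinate is constant on one of the
families. Choose an edge `x`, `y` in `𝒜` with neighbourhood `N`. The part of `N` outside `𝒜` lies in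
the cut, so it suffices to show that the cut has at least `#(N ∩ 𝒜)` vertices outside `N`. The
constant coordinates of `𝒜` supply them, by a swap (`JohnsonSep.card_nbrs_le_of_swap`) or by a
shadow argument (`JohnsonSep.card_nbrs_le_of_disjoint`).

The same argument with a single vertex in place of an edge proves, by induction on `#E`, the vertex
connectivity that it uses. The parameter `r` (1 for a vertex, 2 for an edge) treats both at once in
`JohnsonSep.bound_of_conn`. -/

/-- Two families of `k`-subsets of `E` with no common and no adjacent members in the Johnson
graph on `E`. -/
structure JohnsonSep {α : Type*} [DecidableEq α] (E : Finset α) (k : ℕ)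
    (𝒜 ℬ : Finset (Finset α)) : Prop where
  left : 𝒜 ⊆ powersetCard k E
  right : ℬ ⊆ powersetCard k E
  sep : ∀ a ∈ 𝒜, ∀ b ∈ ℬ, #(a ∩ b) + 2 ≤ k

/-- The `k`-subsets of `E` outside both families. -/
def johnsonCut {α : Type*} [DecidableEq α] (E : Finset α) (k : ℕ) (𝒜 ℬ : Finset (Finset α)) :
    Finset (Finset α) :=
  powersetCard k E \ (𝒜 ∪ ℬ)

/-- The vertices of the Johnson graph on `E` which are different from `x` and `y` and adjacent to
one of them. -/
def johnsonNbrs {α : Type*} [DecidableEq α] (E : Finset α) (k : ℕ) (x y : Finset α) :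
    Finset (Finset α) :=
  {z ∈ powersetCard k E | z ≠ x ∧ z ≠ y ∧ (#(z ∩ x) + 1 = k ∨ #(z ∩ y) + 1 = k)}

/-! ### Complementation and splitting by a coordinate -/

section

variable {α : Type*} [DecidableEq α] {E : Finset α} {k : ℕ} {𝒜 ℬ : Finset (Finset α)}

theorem card_compl_inter_compl {a b : Finset α} (ha : a ∈ powersetCard k E)
    (hb : b ∈ powersetCard k E) : #((E \ a) ∩ (E \ b)) + 2 * k = #E + #(a ∩ b) := by
  rw [mem_powersetCard] at ha hb
  have h1 : (E \ a) ∩ (E \ b) = E \ (a ∪ b) := by ext; simp; tauto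
  have h2 := card_sdiff_add_card_eq_card (union_subset ha.1 hb.1)
  have h3 := card_union_add_card_inter a b
  rw [h1]
  omega

theorem sdiff_mem_powersetCard {a : Finset α} (ha : a ∈ powersetCard k E) :
    E \ a ∈ powersetCard (#E - k) E := by
  rw [mem_powersetCard] at ha ⊢
  exact ⟨sdiff_subset, by rw [card_sdiff_of_subset ha.1, ha.2]⟩

theorem card_image_sdiff (h : 𝒜 ⊆ powersetCard k E) : #(𝒜.image (E \ ·)) = #𝒜 := by
  refine card_image_of_injOn fun a ha b hb hab => ?_
  have h1 := (mem_powersetCard.1 (h ha)).1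
  have h2 := (mem_powersetCard.1 (h hb)).1
  have : E \ (E \ a) = E \ (E \ b) := congrArg (E \ ·) hab
  rwa [Finset.sdiff_sdiff_eq_self h1, Finset.sdiff_sdiff_eq_self h2] at this

namespace JohnsonSep

theorem symm (h : JohnsonSep E k 𝒜 ℬ) : JohnsonSep E k ℬ 𝒜 :=
  ⟨h.right, h.left, fun b hb a ha => by rw [inter_comm]; exact h.sep a ha b hb⟩

theorem disjoint (h : JohnsonSep E k 𝒜 ℬ) : Disjoint 𝒜 ℬ := by
  rw [disjoint_left]
  intro a ha hb
  have h1 := h.sep a ha a hb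
  have h2 := (mem_powersetCard.1 (h.left ha)).2
  rw [inter_self] at h1
  omega

theorem card_cut (h : JohnsonSep E k 𝒜 ℬ) :
    #(johnsonCut E k 𝒜 ℬ) + #𝒜 + #ℬ = (#E).choose k := by
  rw [← card_powersetCard, johnsonCut, add_assoc, ← card_union_of_disjoint h.disjoint]
  exact card_sdiff_add_card_eq_card (union_subset h.left h.right)

theorem compl (h : JohnsonSep E k 𝒜 ℬ) :
    JohnsonSep E (#E - k) (𝒜.image (E \ ·)) (ℬ.image (E \ ·)) where
  left := image_subset_iff.2 fun a ha => sdiff_mem_powersetCard (h.left ha)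
  right := image_subset_iff.2 fun a ha => sdiff_mem_powersetCard (h.right ha)
  sep := by
    simp only [forall_mem_image]
    intro a ha b hb
    have h1 := h.sep a ha b hb
    have h2 := card_compl_inter_compl (h.left ha) (h.right hb)
    omega

theorem le_card (h : JohnsonSep E k 𝒜 ℬ) (hA : 𝒜.Nonempty) : k ≤ #E := by
  obtain ⟨a, ha⟩ := hA
  have := mem_powersetCard.1 (h.left ha)
  exact this.2 ▸ card_le_card this.1

theorem card_cut_compl (h : JohnsonSep E k 𝒜 ℬ) (hk : k ≤ #E) :
    #(johnsonCut E (#E - k) (𝒜.image (E \ ·)) (ℬ.image (E \ ·))) = #(johnsonCut E k 𝒜 ℬ) := by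
  have h1 := h.card_cut
  have h2 := h.compl.card_cut
  rw [card_image_sdiff h.left, card_image_sdiff h.right, Nat.choose_symm hk] at h2
  omega

theorem nonMember (h : JohnsonSep E k 𝒜 ℬ) (i : α) :
    JohnsonSep (E.erase i) k (𝒜.nonMemberSubfamily i) (ℬ.nonMemberSubfamily i) := by
  have key : ∀ 𝒞 ⊆ powersetCard k E, 𝒞.nonMemberSubfamily i ⊆ powersetCard k (E.erase i) := by
    intro 𝒞 hC a ha
    rw [mem_nonMemberSubfamily] at ha
    have := mem_powersetCard.1 (hC ha.1)
    exact mem_powersetCard.2 ⟨subset_erase.2 ⟨this.1, ha.2⟩, this.2⟩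
  refine ⟨key _ h.left, key _ h.right, fun a ha b hb => ?_⟩
  exact h.sep a (mem_nonMemberSubfamily.1 ha).1 b (mem_nonMemberSubfamily.1 hb).1

theorem member (h : JohnsonSep E (k + 1) 𝒜 ℬ) (i : α) :
    JohnsonSep (E.erase i) k (𝒜.memberSubfamily i) (ℬ.memberSubfamily i) := by
  have key : ∀ 𝒞 ⊆ powersetCard (k + 1) E,
      𝒞.memberSubfamily i ⊆ powersetCard k (E.erase i) := by
    intro 𝒞 hC a ha
    rw [mem_memberSubfamily] at ha
    have := mem_powersetCard.1 (hC ha.1)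
    rw [card_insert_of_notMem ha.2] at this
    exact mem_powersetCard.2
      ⟨subset_erase.2 ⟨(subset_insert _ _).trans this.1, ha.2⟩, by omega⟩
  refine ⟨key _ h.left, key _ h.right, fun a ha b hb => ?_⟩
  rw [mem_memberSubfamily] at ha hb
  have := h.sep _ ha.1 _ hb.1
  rw [← insert_inter_distrib, card_insert_of_notMem (by simp [ha.2])] at this
  omega

/-- Pascal's rule for the cut: its members avoiding `i` and those containing `i` are counted
separately. -/
theorem card_cut_split (h : JohnsonSep E (k + 1) 𝒜 ℬ) {i : α} (hi : i ∈ E) :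
    #(johnsonCut E (k + 1) 𝒜 ℬ) =
      #(johnsonCut (E.erase i) (k + 1) (𝒜.nonMemberSubfamily i) (ℬ.nonMemberSubfamily i)) +
      #(johnsonCut (E.erase i) k (𝒜.memberSubfamily i) (ℬ.memberSubfamily i)) := by
  have h1 := h.card_cut
  have h2 := (h.nonMember i).card_cut
  have h3 := (h.member i).card_cut
  have h4 := card_memberSubfamily_add_card_nonMemberSubfamily i 𝒜
  have h5 := card_memberSubfamily_add_card_nonMemberSubfamily i ℬ
  rw [← card_erase_add_one hi, Nat.choose_succ_succ'] at h1
  omega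

/-- If the cut is small, every coordinate is constant on one of the two families. -/
theorem constant_of_card_cut_lt (h : JohnsonSep E k 𝒜 ℬ) {i : α} (hi : i ∈ E)
    (conn : ∀ l 𝒞 𝒟, JohnsonSep (E.erase i) l 𝒞 𝒟 → 𝒞.Nonempty → 𝒟.Nonempty →
      l * (#(E.erase i) - l) ≤ #(johnsonCut (E.erase i) l 𝒞 𝒟))
    (hk : 1 ≤ k) (hkE : k < #E)
    (hcut : #(johnsonCut E k 𝒜 ℬ) + #E < 2 * k * (#E - k)) :
    ((∀ a ∈ 𝒜, i ∈ a) ∨ (∀ a ∈ 𝒜, i ∉ a)) ∨ ((∀ b ∈ ℬ, i ∈ b) ∨ (∀ b ∈ ℬ, i ∉ b)) := by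
  obtain ⟨k, rfl⟩ : ∃ l, k = l + 1 := ⟨k - 1, by omega⟩
  -- If `i` varies on both families, all four subfamilies are nonempty. With `k + 1` for `k` and `#E
  -- = k + 1 + (m + 1)`, connectivity gives at least `(k + 1) * m + k * (m + 1)` cut vertices,
  -- exactly `2 * (k + 1) * (m + 1) - #E`.
  by_contra! hcon
  obtain ⟨⟨⟨a, ha, hia⟩, ⟨a', ha', hia'⟩⟩, ⟨b, hb, hib⟩, ⟨b', hb', hib'⟩⟩ := hcon
  have h0 := conn _ _ _ (h.nonMember i) ⟨a, mem_nonMemberSubfamily.2 ⟨ha, hia⟩⟩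
    ⟨b, mem_nonMemberSubfamily.2 ⟨hb, hib⟩⟩
  have h1 := conn _ _ _ (h.member i)
    ⟨a'.erase i, mem_memberSubfamily.2 ⟨by rwa [insert_erase hia'], by simp⟩⟩
    ⟨b'.erase i, mem_memberSubfamily.2 ⟨by rwa [insert_erase hib'], by simp⟩⟩
  have h2 := h.card_cut_split hi
  obtain ⟨m, hm⟩ : ∃ m, #E = k + 1 + (m + 1) := ⟨#E - k - 2, by omega⟩
  have h3 : #(E.erase i) = k + 1 + m := by rw [card_erase_of_mem hi]; omega
  rw [h3] at h0 h1
  rw [hm] at hcut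
  rw [show k + 1 + m - (k + 1) = m by omega] at h0
  rw [show k + 1 + m - k = m + 1 by omega] at h1
  rw [show k + 1 + (m + 1) - (k + 1) = m + 1 by omega] at hcut
  nlinarith

end JohnsonSep

/-! ### Neighbourhoods -/

theorem mem_johnsonNbrs {x y z : Finset α} : z ∈ johnsonNbrs E k x y ↔
    z ∈ powersetCard k E ∧ z ≠ x ∧ z ≠ y ∧ (#(z ∩ x) + 1 = k ∨ #(z ∩ y) + 1 = k) := by
  simp [johnsonNbrs]

/-- Two sets of equal size `k` meeting in `k - 1` elements differ by a swap. -/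
theorem exists_eq_insert_erase {x z : Finset α} (hx : x ∈ powersetCard k E)
    (hz : z ∈ powersetCard k E)
    (h : #(z ∩ x) + 1 = k) : ∃ u ∈ x, ∃ w ∈ E \ x, z = insert w (x.erase u) := by
  rw [mem_powersetCard] at hx hz
  have h1 := card_sdiff_add_card_inter z x
  have h2 := card_sdiff_add_card_inter x z
  rw [inter_comm] at h2
  obtain ⟨w, hw⟩ := card_eq_one.1 (show #(z \ x) = 1 by omega)
  obtain ⟨u, hu⟩ := card_eq_one.1 (show #(x \ z) = 1 by omega)
  have hw' : ∀ t, t ∈ z ∧ t ∉ x ↔ t = w := fun t => by rw [← mem_sdiff, hw, mem_singleton]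
  have hu' : ∀ t, t ∈ x ∧ t ∉ z ↔ t = u := fun t => by rw [← mem_sdiff, hu, mem_singleton]
  refine ⟨u, ((hu' u).2 rfl).1, w, mem_sdiff.2 ⟨hz.1 ((hw' w).2 rfl).1, ((hw' w).2 rfl).2⟩, ?_⟩
  ext t
  have := hw' t
  have := hu' t
  simp only [mem_insert, mem_erase]
  grind

theorem swap_spec {x : Finset α} (hx : x ∈ powersetCard k E) {u w : α} (hu : u ∈ x)
    (hw : w ∈ E \ x) : insert w (x.erase u) ∈ powersetCard k E ∧
      #(insert w (x.erase u) ∩ x) + 1 = k := by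
  rw [mem_powersetCard] at hx ⊢
  rw [mem_sdiff] at hw
  have h1 := card_erase_add_one hu
  refine ⟨⟨insert_subset hw.1 ((erase_subset _ _).trans hx.1), ?_⟩, ?_⟩
  · rw [card_insert_of_notMem (by simp [hw.2])]; omega
  · rw [insert_inter_of_notMem hw.2, inter_eq_left.2 (erase_subset _ _)]; omega

theorem swap_injOn (x : Finset α) (s : Set (α × α)) (hs : ∀ p ∈ s, p.1 ∈ x ∧ p.2 ∉ x) :
    Set.InjOn (fun p : α × α => insert p.2 (x.erase p.1)) s := by
  rintro ⟨u, w⟩ h ⟨u', w'⟩ h' heq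
  have h1 := hs _ h
  have h2 := hs _ h'
  simp only at heq h1 h2
  rw [Finset.ext_iff] at heq
  simp only [mem_insert, mem_erase] at heq
  have := heq u
  have := heq w
  grind

theorem card_johnsonNbrs_self {x : Finset α} (hx : x ∈ powersetCard k E) :
    #(johnsonNbrs E k x x) = k * (#E - k) := by
  have h : johnsonNbrs E k x x =
      (x ×ˢ (E \ x)).image (fun p : α × α => insert p.2 (x.erase p.1)) := by
    ext z
    simp only [mem_johnsonNbrs, mem_image, mem_product, Prod.exists]
    constructor
    · rintro ⟨hz, -, -, h | h⟩
      all_goals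
        obtain ⟨u, hu, w, hw, rfl⟩ := exists_eq_insert_erase hx hz h
        exact ⟨u, w, ⟨hu, hw⟩, rfl⟩
    · rintro ⟨u, w, ⟨hu, hw⟩, rfl⟩
      obtain ⟨h1, h2⟩ := swap_spec hx hu hw
      have : insert w (x.erase u) ≠ x := by
        intro h
        rw [h, inter_self, (mem_powersetCard.1 hx).2] at h2
        omega
      exact ⟨h1, this, this, Or.inl h2⟩
  rw [h, card_image_of_injOn (swap_injOn x _ (by simp +contextual)), card_product,
    card_sdiff_of_subset (mem_powersetCard.1 hx).1, (mem_powersetCard.1 hx).2]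

/-- Let `y` arise from `x` by replacing `a` with `b`. The neighbours of `x` other than `y` are the
swaps of `x` except `(a, b)`. A swap of `y` that removes `b` or inserts `a` gives `x` or a neighbour
of `x`, so only `(k - 1) * (#E - k - 1)` swaps of `y` are new. -/
theorem card_johnsonNbrs_of_adj {x y : Finset α} (hx : x ∈ powersetCard k E)
    (hy : y ∈ powersetCard k E) (hxy : #(y ∩ x) + 1 = k) :
    #(johnsonNbrs E k x y) + #E = 2 * k * (#E - k) := by
  obtain ⟨a, ha, b, hb, hy'⟩ := exists_eq_insert_erase hx hy hxy
  have hbE := (mem_sdiff.1 hb).1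
  have hbx := (mem_sdiff.1 hb).2
  have hab : a ≠ b := fun h => hbx (h ▸ ha)
  have hby : b ∈ y := by simp [hy']
  have hay : a ∉ y := by simp [hy', hab]
  have hey : y.erase b = x.erase a := by rw [hy', erase_insert (by simp [hbx])]
  set I₁ := ((x ×ˢ (E \ x)).erase (a, b)).image
    (fun p : α × α => insert p.2 (x.erase p.1)) with hI₁
  set I₂ := ((x.erase a) ×ˢ (E \ insert b x)).image
    (fun p : α × α => insert p.2 (y.erase p.1)) with hI₂
  have hyx : ∀ t, t ∈ y ↔ t = b ∨ (t ≠ a ∧ t ∈ x) := by intro t; rw [hy']; simp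
  have hne : ∀ z, #(z ∩ x) + 1 = k → z ≠ x := by
    rintro z hz rfl
    rw [inter_self, (mem_powersetCard.1 hx).2] at hz
    omega
  have hne' : ∀ z, #(z ∩ y) + 1 = k → z ≠ y := by
    rintro z hz rfl
    rw [inter_self, (mem_powersetCard.1 hy).2] at hz
    omega
  have hN : johnsonNbrs E k x y = I₁ ∪ I₂ := by
    ext z
    simp only [mem_johnsonNbrs, hI₁, hI₂, mem_union, mem_image, mem_product, mem_erase,
      Prod.exists, Prod.mk.injEq, ne_eq]
    constructor
    · rintro ⟨hz, hzx, hzy, h⟩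
      by_cases hzx' : #(z ∩ x) + 1 = k
      · left
        obtain ⟨u, hu, w, hw, rfl⟩ := exists_eq_insert_erase hx hz hzx'
        refine ⟨u, w, ⟨?_, hu, hw⟩, rfl⟩
        rintro ⟨rfl, rfl⟩
        exact hzy hy'.symm
      · right
        obtain ⟨u, hu, w, hw, rfl⟩ := exists_eq_insert_erase hy hz (by tauto)
        rw [mem_sdiff] at hw
        have hub : u ≠ b := by
          rintro rfl
          rw [hey] at hzx' hzx
          have hwx : w ∉ x := by
            intro hwx
            have : w = a := by
              by_contra hwa
              exact hw.2 ((hyx w).2 (Or.inr ⟨hwa, hwx⟩))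
            subst this
            exact hzx (insert_erase ha)
          exact hzx' (swap_spec hx ha (mem_sdiff.2 ⟨hw.1, hwx⟩)).2
        have hux : u ≠ a ∧ u ∈ x := ((hyx u).1 hu).resolve_left hub
        have hwa : w ≠ a := by
          rintro rfl
          refine hzx' ?_
          have : insert w (y.erase u) = insert b (x.erase u) := by
            ext t
            simp only [mem_insert, mem_erase, hyx]
            grind
          rw [this]
          exact (swap_spec hx hux.2 hb).2
        refine ⟨u, w, ⟨hux, mem_sdiff.2 ⟨hw.1, ?_⟩⟩, rfl⟩
        have := hyx w
        simp only [mem_insert]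
        grind
    · rintro (⟨u, w, ⟨hne1, hu, hw⟩, rfl⟩ | ⟨u, w, ⟨⟨hua, hu⟩, hw⟩, rfl⟩)
      · obtain ⟨h1, h2⟩ := swap_spec hx hu hw
        refine ⟨h1, hne _ h2, ?_, Or.inl h2⟩
        intro h
        rw [hy'] at h
        have := swap_injOn x {p | p.1 ∈ x ∧ p.2 ∉ x} (fun p hp => hp)
          (show (u, w) ∈ _ from ⟨hu, (mem_sdiff.1 hw).2⟩)
          (show (a, b) ∈ _ from ⟨ha, hbx⟩) h
        rw [Prod.mk.injEq] at this
        exact hne1 this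
      · rw [mem_sdiff, mem_insert] at hw
        push Not at hw
        have hwy : w ∉ y := by rw [hyx]; grind
        obtain ⟨h1, h2⟩ := swap_spec hy ((hyx u).2 (Or.inr ⟨hua, hu⟩))
          (mem_sdiff.2 ⟨hw.1, hwy⟩)
        refine ⟨h1, ?_, hne' _ h2, Or.inr h2⟩
        intro h
        exact hw.2.2 (h ▸ mem_insert_self _ _)
  have hdisj : Disjoint I₁ I₂ := by
    rw [disjoint_left]
    intro z hz1 hz2
    simp only [hI₁, hI₂, mem_image, mem_product, mem_erase, mem_sdiff, mem_insert, Prod.exists]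
      at hz1 hz2
    obtain ⟨u, w, ⟨-, hu, hw⟩, rfl⟩ := hz1
    obtain ⟨u', w', ⟨hu', hw'⟩, heq⟩ := hz2
    rw [Finset.ext_iff] at heq
    simp only [mem_insert, mem_erase, hyx] at heq
    have h1 := heq b
    have h2 := heq w'
    grind
  have hc1 : #I₁ + 1 = k * (#E - k) := by
    have hm : (a, b) ∈ x ×ˢ (E \ x) := mem_product.2 ⟨ha, hb⟩
    rw [hI₁, card_image_of_injOn (swap_injOn x _ (by
      intro p hp
      simp only [coe_erase, coe_product, Set.mem_sdiff, Set.mem_prod, mem_coe] at hp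
      exact ⟨hp.1.1, (mem_sdiff.1 hp.1.2).2⟩)), card_erase_add_one hm, card_product,
      card_sdiff_of_subset (mem_powersetCard.1 hx).1, (mem_powersetCard.1 hx).2]
  have hc2 : #I₂ = (k - 1) * (#E - k - 1) := by
    rw [hI₂, card_image_of_injOn (swap_injOn y _ (by
      intro p hp
      simp only [coe_product, Set.mem_prod, mem_coe, mem_sdiff, mem_insert, mem_erase] at hp
      rw [hyx, hyx]
      grind)), card_product, card_erase_of_mem ha,
      card_sdiff_of_subset (insert_subset hbE (mem_powersetCard.1 hx).1),
      card_insert_of_notMem hbx, (mem_powersetCard.1 hx).2, Nat.sub_add_eq]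
  have hk : 1 ≤ k := by omega
  have hkE : k < #E := by
    have := card_le_card (insert_subset hbE (mem_powersetCard.1 hx).1)
    rw [card_insert_of_notMem hbx, (mem_powersetCard.1 hx).2] at this
    omega
  rw [hN, card_union_of_disjoint hdisj, hc2]
  obtain ⟨l, rfl⟩ : ∃ l, k = l + 1 := ⟨k - 1, by omega⟩
  obtain ⟨m, hm⟩ : ∃ m, #E = l + 1 + (m + 1) := ⟨#E - l - 2, by omega⟩
  rw [hm] at hc1 ⊢
  rw [show l + 1 + (m + 1) - (l + 1) = m + 1 by omega] at hc1 ⊢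
  simp only [Nat.add_sub_cancel]
  nlinarith

end

/-! ### Lower bounds for cuts by neighbourhoods -/

section

variable {α : Type*} [DecidableEq α] {E : Finset α} {k : ℕ} {𝒜 ℬ : Finset (Finset α)}

namespace JohnsonSep

theorem mem_cut_of_adj (h : JohnsonSep E k 𝒜 ℬ) {a z : Finset α} (ha : a ∈ 𝒜)
    (hz : z ∈ powersetCard k E) (hza : #(z ∩ a) + 1 = k) (hz' : z ∉ 𝒜) :
    z ∈ johnsonCut E k 𝒜 ℬ := by
  rw [johnsonCut, mem_sdiff, mem_union]
  refine ⟨hz, ?_⟩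
  rintro (hA | hB)
  · exact hz' hA
  · have := h.sep a ha z hB
    rw [inter_comm] at this
    omega

/-- Neighbours of `x` and `y` lie in `𝒜` or in the cut; those lost to `𝒜` only have to be
compensated by cut vertices outside the neighbourhood. -/
theorem card_nbrs_le_of_card_le (h : JohnsonSep E k 𝒜 ℬ) {x y : Finset α} (hx : x ∈ 𝒜)
    (hy : y ∈ 𝒜) (hc : #(johnsonNbrs E k x y ∩ 𝒜) ≤
      #(johnsonCut E k 𝒜 ℬ \ johnsonNbrs E k x y)) :
    #(johnsonNbrs E k x y) ≤ #(johnsonCut E k 𝒜 ℬ) := by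
  have h1 : johnsonNbrs E k x y \ 𝒜 ⊆ johnsonCut E k 𝒜 ℬ ∩ johnsonNbrs E k x y := by
    intro z hz
    rw [mem_sdiff] at hz
    refine mem_inter.2 ⟨?_, hz.1⟩
    obtain ⟨hzE, -, -, hzx | hzy⟩ := mem_johnsonNbrs.1 hz.1
    · exact h.mem_cut_of_adj hx hzE hzx hz.2
    · exact h.mem_cut_of_adj hy hzE hzy hz.2
  have h2 := card_le_card h1
  have h3 := card_sdiff_add_card_inter (johnsonNbrs E k x y) 𝒜
  have h4 := card_sdiff_add_card_inter (johnsonCut E k 𝒜 ℬ) (johnsonNbrs E k x y)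
  omega

/-- If all members of `𝒜` contain `c` and avoid `d`, then swapping `c` for `d` sends the
neighbours of `x` and `y` inside `𝒜` to vertices of the cut that are adjacent to neither. -/
theorem card_nbrs_le_of_swap (h : JohnsonSep E k 𝒜 ℬ) {x y : Finset α} (hx : x ∈ 𝒜)
    (hy : y ∈ 𝒜) {c d : α} (hd : d ∈ E) (hcA : ∀ a ∈ 𝒜, c ∈ a) (hdA : ∀ a ∈ 𝒜, d ∉ a) :
    #(johnsonNbrs E k x y) ≤ #(johnsonCut E k 𝒜 ℬ) := by
  refine h.card_nbrs_le_of_card_le hx hy ?_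
  refine card_le_card_of_injOn (fun z => insert d (z.erase c)) ?_ ?_
  · intro z hz
    rw [mem_coe, mem_inter, mem_johnsonNbrs] at hz
    obtain ⟨⟨hzE, hzx, hzy, -⟩, hzA⟩ := hz
    obtain ⟨h1, h2⟩ := swap_spec hzE (hcA z hzA) (mem_sdiff.2 ⟨hd, hdA z hzA⟩)
    -- The swap removes the common element `c` and adds nothing of `a`, so the intersection with `a`
    -- drops by one; size `k - 1` afterwards would mean `z = a`.
    have far : ∀ a ∈ 𝒜, z ≠ a → #(insert d (z.erase c) ∩ a) + 1 ≠ k := by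
      intro a ha hza
      have hac := (mem_powersetCard.1 (h.left ha)).2
      have hzc := (mem_powersetCard.1 hzE).2
      have : insert d (z.erase c) ∩ a = (z ∩ a).erase c := by
        rw [insert_inter_of_notMem (hdA a ha), erase_inter]
      rw [this, card_erase_add_one (mem_inter.2 ⟨hcA z hzA, hcA a ha⟩)]
      intro hcard
      have e1 : z ∩ a = z := eq_of_subset_of_card_le inter_subset_left (by omega)
      have e2 : z ∩ a = a := eq_of_subset_of_card_le inter_subset_right (by omega)
      exact hza (e1.symm.trans e2)
    simp only [mem_coe, mem_sdiff]
    refine ⟨h.mem_cut_of_adj hzA h1 h2 fun hA => hdA _ hA (mem_insert_self _ _), ?_⟩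
    rw [mem_johnsonNbrs]
    rintro ⟨-, -, -, h3 | h3⟩
    · exact far x hx hzx h3
    · exact far y hy hzy h3
  · intro z hz z' hz' heq
    simp only [coe_inter, Set.mem_inter_iff, mem_coe] at hz hz'
    have h1 := hcA z hz.2
    have h2 := hcA z' hz'.2
    have h3 := hdA z hz.2
    have h4 := hdA z' hz'.2
    simp only [Finset.ext_iff, mem_insert, mem_erase] at heq ⊢
    intro t
    have := heq t
    grind

/-- If all members of `𝒜` avoid a large set `F`, then lowering a neighbour of `x` and `y` inside
`𝒜` and adding an element of `F` gives enough further vertices of the cut. -/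
theorem card_nbrs_le_of_disjoint (h : JohnsonSep E k 𝒜 ℬ) {x y : Finset α} (hx : x ∈ 𝒜)
    (hy : y ∈ 𝒜) {r : ℕ} (hr : #{x, y} ≤ r) (hxy : k + 1 ≤ #(x ∩ y) + r) (hk : r + 1 ≤ k)
    {F : Finset α} (hFE : F ⊆ E) (hF : r + 1 ≤ #F) (hFA : ∀ a ∈ 𝒜, Disjoint a F) :
    #(johnsonNbrs E k x y) ≤ #(johnsonCut E k 𝒜 ℬ) := by
  refine h.card_nbrs_le_of_card_le hx hy ?_
  have hcard : ∀ a ∈ 𝒜, #a = k := fun a ha => (mem_powersetCard.1 (h.left ha)).2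
  -- Keep in `t` a point of `z` outside `x` and one outside `y`; these are at most `r ≤ k - 1`
  -- points.
  have hlow : ∀ z ∈ johnsonNbrs E k x y ∩ 𝒜, ∃ t ⊆ z, #t = k - 1 ∧ ¬ t ⊆ x ∧ ¬ t ⊆ y := by
    intro z hz
    rw [mem_inter, mem_johnsonNbrs] at hz
    obtain ⟨⟨hzE, hzx, hzy, -⟩, hzA⟩ := hz
    have hex : ∀ a ∈ 𝒜, z ≠ a → ∃ p ∈ z, p ∉ a := by
      intro a ha hza
      by_contra! hcon
      exact hza (eq_of_subset_of_card_le hcon (by rw [hcard a ha, hcard z hzA]))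
    have hex2 : ∃ p q, p ∈ z ∧ p ∉ x ∧ q ∈ z ∧ q ∉ y ∧ #{p, q} ≤ #{x, y} := by
      obtain ⟨p, hp, hpx⟩ := hex x hx hzx
      obtain ⟨q, hq, hqy⟩ := hex y hy hzy
      by_cases hxy' : x = y
      · exact ⟨p, p, hp, hpx, hp, hxy' ▸ hpx, by simp [hxy']⟩
      · refine ⟨p, q, hp, hpx, hq, hqy, ?_⟩
        rw [card_pair hxy']
        exact card_le_two
    obtain ⟨p, q, hp, hpx, hq, hqy, hpq⟩ := hex2
    obtain ⟨t, ht1, ht2, ht3⟩ := exists_subsuperset_card_eq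
      (show ({p, q} : Finset α) ⊆ z by grind) (show #{p, q} ≤ k - 1 by omega)
      (by rw [hcard z hzA]; omega)
    exact ⟨t, ht2, ht3, fun hh => hpx (hh (ht1 (by simp))), fun hh => hqy (hh (ht1 (by simp)))⟩
  choose! t htz htc htx hty using hlow
  set N := johnsonNbrs E k x y ∩ 𝒜 with hN
  -- The point restored to `t` must lie in `x ∪ y`, since `t` is contained in neither set. As `#(x ∪
  -- y) ≤ k + r - 1` and `t` contains at least `k - 2` of these points, there are at most `r + 1`
  -- choices.
  have hfib : #N ≤ (r + 1) * #(N.image t) := by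
    refine card_le_mul_card_image N (r + 1) ?_
    intro s hs
    by_cases hne : (N.filter (fun z => t z = s)).Nonempty
    swap
    · rw [not_nonempty_iff_eq_empty.1 hne]; simp
    have hsub : N.filter (fun z => t z = s) ⊆ ((x ∪ y) \ s).image (fun w => insert w s) := by
      intro z hz
      rw [mem_filter] at hz
      obtain ⟨hzN, rfl⟩ := hz
      have hzA := (mem_inter.1 hzN).2
      obtain ⟨w, hw⟩ := card_eq_one.1 (show #(z \ t z) = 1 by
        rw [card_sdiff_of_subset (htz z hzN), hcard z hzA, htc z hzN]; omega)
      have hwz : w ∈ z \ t z := by rw [hw]; simp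
      have hzw : z = insert w (t z) := by
        rw [insert_eq, ← hw, sdiff_union_of_subset (htz z hzN)]
      have key : ∀ a, #(z ∩ a) + 1 = k → ¬ t z ⊆ a → w ∈ a := by
        intro a hza hta
        by_contra hwa
        have e : z ∩ a = t z ∩ a := by
          conv_lhs => rw [hzw]
          rw [insert_inter_of_notMem hwa]
        have h1 := htc z hzN
        rw [e] at hza
        exact hta (inter_eq_left.1 (eq_of_subset_of_card_le inter_subset_left (by omega)))
      refine mem_image.2 ⟨w, mem_sdiff.2 ⟨?_, (mem_sdiff.1 hwz).2⟩, hzw.symm⟩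
      obtain ⟨-, -, -, h1 | h1⟩ := mem_johnsonNbrs.1 (mem_inter.1 hzN).1
      · exact mem_union_left _ (key x h1 (htx z hzN))
      · exact mem_union_right _ (key y h1 (hty z hzN))
    refine (card_le_card hsub).trans (card_image_le.trans ?_)
    obtain ⟨z, hz⟩ := hne
    obtain ⟨hzN, rfl⟩ := mem_filter.1 hz
    have hzA := (mem_inter.1 hzN).2
    have key : ∀ a ⊆ x ∪ y, #(z ∩ a) + 1 = k → k ≤ #((x ∪ y) ∩ t z) + 2 := by
      intro a ha hza
      have h1 := card_le_card (show z ∩ a ⊆ ((x ∪ y) ∩ t z) ∪ (z \ t z) by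
        intro p hp
        rw [mem_inter] at hp
        by_cases hpt : p ∈ t z
        · exact mem_union_left _ (mem_inter.2 ⟨ha hp.2, hpt⟩)
        · exact mem_union_right _ (mem_sdiff.2 ⟨hp.1, hpt⟩))
      have h2 := card_union_le ((x ∪ y) ∩ t z) (z \ t z)
      have h3 : #(z \ t z) = k - (k - 1) := by
        rw [card_sdiff_of_subset (htz z hzN), hcard z hzA, htc z hzN]
      omega
    have h1 : k ≤ #((x ∪ y) ∩ t z) + 2 := by
      obtain ⟨-, -, -, h1 | h1⟩ := mem_johnsonNbrs.1 (mem_inter.1 hzN).1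
      · exact key x subset_union_left h1
      · exact key y subset_union_right h1
    have h2 := card_sdiff_add_card_inter (x ∪ y) (t z)
    have h3 := card_union_add_card_inter x y
    have h4 := hcard x hx
    have h5 := hcard y hy
    omega
  have hFt : ∀ z ∈ N, ∀ j ∈ F, j ∉ z := fun z hz j hj hjz =>
    disjoint_left.1 (hFA z (mem_inter.1 hz).2) hjz hj
  -- Adding `j ∈ F` to `t` leaves `𝒜` but stays adjacent to `z`, hence gives a cut vertex. It is
  -- adjacent to neither `x` nor `y`, as both avoid `j` and neither contains `t`; and `j` can be
  -- recovered, since no `t` meets `F`.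
  have hinj : #(N.image t ×ˢ F) ≤ #(johnsonCut E k 𝒜 ℬ \ johnsonNbrs E k x y) := by
    refine card_le_card_of_injOn (fun p => insert p.2 p.1) ?_ ?_
    · rintro ⟨s, j⟩ hp
      rw [mem_coe, mem_product, mem_image] at hp
      obtain ⟨⟨z, hzN, rfl⟩, hj⟩ := hp
      simp only at hj
      have hzA := (mem_inter.1 hzN).2
      have hjz := hFt z hzN j hj
      have hjt : j ∉ t z := fun hh => hjz (htz z hzN hh)
      have h1 := htc z hzN
      simp only [mem_coe, mem_sdiff]
      refine ⟨h.mem_cut_of_adj hzA (mem_powersetCard.2 ⟨?_, ?_⟩) ?_ ?_, ?_⟩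
      · exact insert_subset (hFE hj)
          ((htz z hzN).trans (mem_powersetCard.1 (h.left hzA)).1)
      · rw [card_insert_of_notMem hjt]; omega
      · rw [insert_inter_of_notMem hjz, inter_eq_left.2 (htz z hzN)]; omega
      · intro hA
        exact disjoint_left.1 (hFA _ hA) (mem_insert_self _ _) hj
      · rw [mem_johnsonNbrs]
        have key : ∀ a ∈ 𝒜, ¬ t z ⊆ a → #(insert j (t z) ∩ a) + 1 ≠ k := by
          intro a ha hta hcon
          rw [insert_inter_of_notMem (fun hja => disjoint_left.1 (hFA a ha) hja hj)] at hcon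
          exact hta (inter_eq_left.1 (eq_of_subset_of_card_le inter_subset_left (by omega)))
        rintro ⟨-, -, -, h3 | h3⟩
        · exact key x hx (htx z hzN) h3
        · exact key y hy (hty z hzN) h3
    · rintro ⟨s, j⟩ hp ⟨s', j'⟩ hp' heq
      rw [mem_coe, mem_product, mem_image] at hp hp'
      obtain ⟨⟨z, hzN, rfl⟩, hj⟩ := hp
      obtain ⟨⟨z', hzN', rfl⟩, hj'⟩ := hp'
      simp only at hj hj' heq
      have hnot : ∀ z ∈ N, ∀ j ∈ F, j ∉ t z := fun z hz j hj hh => hFt z hz j hj (htz z hz hh)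
      have hjj : j = j' := by
        have : j ∈ insert j' (t z') := heq ▸ mem_insert_self _ _
        exact (mem_insert.1 this).resolve_right (hnot z' hzN' j hj)
      subst hjj
      have : (insert j (t z)).erase j = (insert j (t z')).erase j := by rw [heq]
      rw [erase_insert (hnot z hzN j hj), erase_insert (hnot z' hzN' j hj)] at this
      rw [this]
  calc #N ≤ (r + 1) * #(N.image t) := hfib
    _ ≤ #F * #(N.image t) := Nat.mul_le_mul_right _ hF
    _ = #(N.image t ×ˢ F) := by rw [card_product, mul_comm]
    _ ≤ _ := hinj

end JohnsonSep

/-- The closed form of `card_johnsonNbrs_self` and `card_johnsonNbrs_of_adj` taken together. -/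
theorem card_johnsonNbrs {x y : Finset α} (hx : x ∈ powersetCard k E)
    (hy : y ∈ powersetCard k E) {r : ℕ} (hr : #{x, y} = r) (hxy : k + 1 ≤ #(x ∩ y) + r) :
    #(johnsonNbrs E k x y) + (r - 1) * #E = r * k * (#E - k) := by
  by_cases h : x = y
  · subst h
    have : r = 1 := by simpa using hr.symm
    subst this
    simpa using card_johnsonNbrs_self hx
  · rw [card_pair h] at hr
    subst hr
    have hne : #(y ∩ x) ≠ k := by
      intro hcon
      have h1 := (mem_powersetCard.1 hx).2
      have h2 := (mem_powersetCard.1 hy).2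
      have e1 : y ∩ x = y := eq_of_subset_of_card_le inter_subset_left (by omega)
      have e2 : y ∩ x = x := eq_of_subset_of_card_le inter_subset_right (by omega)
      exact h (e2.symm.trans e1)
    have hle := card_le_card (inter_subset_left (s₁ := y) (s₂ := x))
    rw [(mem_powersetCard.1 hy).2] at hle
    rw [inter_comm] at hxy
    simpa using card_johnsonNbrs_of_adj hx hy (by omega)

/-- A uniform family whose members agree outside `Q` and with more than `r ∈ {1, 2}` members needs
more than `r` varying coordinates. -/
theorem lt_card_of_lt_card_family (hB : ℬ ⊆ powersetCard k E) {Q : Finset α}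
    (hQ : ∀ i ∈ E \ Q, (∀ b ∈ ℬ, i ∈ b) ∨ (∀ b ∈ ℬ, i ∉ b)) {r : ℕ} (hr1 : 1 ≤ r)
    (hr2 : r ≤ 2) (hcard : r < #ℬ) : r < #Q := by
  obtain ⟨b₀, hb₀⟩ : ℬ.Nonempty := card_pos.1 (by omega)
  have hout : ∀ b ∈ ℬ, b \ Q = b₀ \ Q := by
    intro b hb
    ext i
    have h1 := (mem_powersetCard.1 (hB hb)).1
    have h2 := (mem_powersetCard.1 (hB hb₀)).1
    simp only [mem_sdiff]
    constructor
    · rintro ⟨hi, hiQ⟩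
      rcases hQ i (mem_sdiff.2 ⟨h1 hi, hiQ⟩) with h | h
      · exact ⟨h _ hb₀, hiQ⟩
      · exact absurd hi (h _ hb)
    · rintro ⟨hi, hiQ⟩
      rcases hQ i (mem_sdiff.2 ⟨h2 hi, hiQ⟩) with h | h
      · exact ⟨h _ hb, hiQ⟩
      · exact absurd hi (h _ hb₀)
  have hle : #ℬ ≤ #(powersetCard #(b₀ ∩ Q) Q) := by
    refine card_le_card_of_injOn (· ∩ Q) ?_ ?_
    · intro b hb
      simp only [mem_coe, mem_powersetCard]
      refine ⟨inter_subset_right, ?_⟩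
      have h1 := card_sdiff_add_card_inter b Q
      have h2 := card_sdiff_add_card_inter b₀ Q
      rw [hout b hb, (mem_powersetCard.1 (hB hb)).2] at h1
      rw [(mem_powersetCard.1 (hB hb₀)).2] at h2
      omega
    · intro b hb b' hb' heq
      simp only at heq
      rw [← sdiff_union_inter b Q, ← sdiff_union_inter b' Q, hout b hb, hout b' hb', heq]
  rw [card_powersetCard] at hle
  have hbQ := card_le_card (inter_subset_right (s₁ := b₀) (s₂ := Q))
  by_contra! hcon
  -- For `q ≤ 2` every binomial coefficient `q.choose j` is at most `max q 1`, hence at most `r`.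
  have hq : #Q ≤ 2 := by omega
  generalize #Q = q at *
  generalize #(b₀ ∩ Q) = j at *
  interval_cases q <;> interval_cases j <;> simp_all [Nat.choose] <;> omega

namespace JohnsonSep

/-- The lower bound when every coordinate is constant on one of the families. -/
theorem bound_of_constant (h : JohnsonSep E k 𝒜 ℬ) {r : ℕ} (hr1 : 1 ≤ r) (hr2 : r ≤ 2)
    (hk : r + 1 ≤ k) (hm : r + 1 ≤ #E - k)
    (hconst : ∀ i ∈ E, ((∀ a ∈ 𝒜, i ∈ a) ∨ (∀ a ∈ 𝒜, i ∉ a)) ∨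
      ((∀ b ∈ ℬ, i ∈ b) ∨ (∀ b ∈ ℬ, i ∉ b)))
    (hB : r < #ℬ) {x y : Finset α} (hx : x ∈ 𝒜) (hy : y ∈ 𝒜) (hr : #{x, y} = r)
    (hxy : k + 1 ≤ #(x ∩ y) + r) :
    r * k * (#E - k) ≤ #(johnsonCut E k 𝒜 ℬ) + (r - 1) * #E := by
  have hkE := h.le_card ⟨x, hx⟩
  set C := E.filter (fun i => ∀ a ∈ 𝒜, i ∈ a) with hC
  set D := E.filter (fun i => ∀ a ∈ 𝒜, i ∉ a) with hD
  -- A coordinate outside `C ∪ D` varies on `𝒜`, so it is constant on `ℬ`.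
  have hQ : r < #(C ∪ D) := by
    refine lt_card_of_lt_card_family h.right (fun i hi => ?_) hr1 hr2 hB
    rw [mem_sdiff, mem_union, mem_filter, mem_filter] at hi
    have := hconst i hi.1
    tauto
  have hN := card_johnsonNbrs (h.left hx) (h.left hy) hr hxy
  suffices #(johnsonNbrs E k x y) ≤ #(johnsonCut E k 𝒜 ℬ) by omega
  rcases C.eq_empty_or_nonempty with hC0 | ⟨c, hc⟩
  · rw [hC0, empty_union] at hQ
    refine h.card_nbrs_le_of_disjoint hx hy hr.le hxy hk (F := D) (filter_subset _ _) hQ ?_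
    intro a ha
    rw [disjoint_left]
    intro i hia hiD
    exact (mem_filter.1 hiD).2 a ha hia
  rcases D.eq_empty_or_nonempty with hD0 | ⟨d, hd⟩
  · rw [hD0, union_empty] at hQ
    -- Complementation turns the common elements `C` into commonly avoided ones, reducing to the
    -- previous case.
    have hx' := mem_image_of_mem (E \ ·) hx
    have hy' := mem_image_of_mem (E \ ·) hy
    have hr' : #{E \ x, E \ y} = r := by
      rw [← hr]
      have : ({E \ x, E \ y} : Finset (Finset α)) = ({x, y} : Finset (Finset α)).image (E \ ·) := by
        simp
      rw [this]
      refine card_image_sdiff (k := k) ?_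
      rw [insert_subset_iff, singleton_subset_iff]
      exact ⟨h.left hx, h.left hy⟩
    have hxy' : (#E - k) + 1 ≤ #((E \ x) ∩ (E \ y)) + r := by
      have := card_compl_inter_compl (h.left hx) (h.left hy)
      omega
    have key := h.compl.card_nbrs_le_of_disjoint hx' hy' hr'.le hxy' hm (F := C)
      (filter_subset _ _) hQ (by
        simp only [forall_mem_image]
        intro a ha
        rw [disjoint_left]
        intro i hia hiC
        exact (mem_sdiff.1 hia).2 ((mem_filter.1 hiC).2 a ha))
    have hN' := card_johnsonNbrs (h.compl.left hx') (h.compl.left hy') hr' hxy'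
    rw [h.card_cut_compl hkE] at key
    rw [Nat.sub_sub_self hkE, mul_assoc, mul_comm (#E - k), ← mul_assoc] at hN'
    omega
  · exact h.card_nbrs_le_of_swap hx hy (mem_filter.1 hd).1 (mem_filter.1 hc).2
      (mem_filter.1 hd).2

/-- Here `𝒜` is just `{x, y}`, so no neighbour is lost to `𝒜`. -/
theorem bound_of_card_le (h : JohnsonSep E k 𝒜 ℬ) {r : ℕ} (hA : #𝒜 ≤ r) {x y : Finset α}
    (hx : x ∈ 𝒜) (hy : y ∈ 𝒜) (hr : #{x, y} = r) (hxy : k + 1 ≤ #(x ∩ y) + r) :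
    r * k * (#E - k) ≤ #(johnsonCut E k 𝒜 ℬ) + (r - 1) * #E := by
  have hN := card_johnsonNbrs (h.left hx) (h.left hy) hr hxy
  suffices #(johnsonNbrs E k x y) ≤ #(johnsonCut E k 𝒜 ℬ) by omega
  refine h.card_nbrs_le_of_card_le hx hy ?_
  have hAeq : ({x, y} : Finset (Finset α)) = 𝒜 :=
    eq_of_subset_of_card_le (by grind) (by omega)
  have : johnsonNbrs E k x y ∩ 𝒜 = ∅ := by
    rw [← hAeq]
    ext z
    simp only [mem_inter, mem_johnsonNbrs]
    grind
  simp [this]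

/-- The common induction step of the bounds for vertices (`r = 1`) and edges (`r = 2`). -/
theorem bound_of_conn (h : JohnsonSep E k 𝒜 ℬ) {r : ℕ} (hr1 : 1 ≤ r) (hr2 : r ≤ 2)
    (hk : r + 1 ≤ k) (hm : r + 1 ≤ #E - k)
    (conn : ∀ i ∈ E, ∀ l 𝒞 𝒟, JohnsonSep (E.erase i) l 𝒞 𝒟 → 𝒞.Nonempty → 𝒟.Nonempty →
      l * (#(E.erase i) - l) ≤ #(johnsonCut (E.erase i) l 𝒞 𝒟))
    {x y : Finset α} (hx : x ∈ 𝒜) (hy : y ∈ 𝒜) (hr : #{x, y} = r)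
    (hxy : k + 1 ≤ #(x ∩ y) + r) {x' y' : Finset α} (hx' : x' ∈ ℬ) (hy' : y' ∈ ℬ)
    (hr' : #{x', y'} = r) (hxy' : k + 1 ≤ #(x' ∩ y') + r) :
    r * k * (#E - k) ≤ #(johnsonCut E k 𝒜 ℬ) + (r - 1) * #E := by
  have hcomm : johnsonCut E k ℬ 𝒜 = johnsonCut E k 𝒜 ℬ := by
    rw [johnsonCut, johnsonCut, union_comm]
  rcases le_or_gt #𝒜 r with hA | hA
  · exact h.bound_of_card_le hA hx hy hr hxy
  rcases le_or_gt #ℬ r with hB | hB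
  · rw [← hcomm]
    exact h.symm.bound_of_card_le hB hx' hy' hr' hxy'
  by_contra! hlt
  refine absurd (h.bound_of_constant hr1 hr2 hk hm (fun i hi => ?_) hB hx hy hr hxy) hlt.not_ge
  refine h.constant_of_card_cut_lt hi (conn i hi) (by omega) (by omega) ?_
  obtain ⟨m, hm'⟩ : ∃ m, #E = k + m := ⟨#E - k, by omega⟩
  rw [hm', Nat.add_sub_cancel_left] at hlt hm ⊢
  -- For `r = 1` the threshold suffices because `k * m - (k + m) = (k - 1) * (m - 1) - 1 ≥ 0`; for
  -- `r = 2` it is the negated bound itself.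
  interval_cases r
  · simp only [one_mul, Nat.sub_self, zero_mul, add_zero] at hlt
    nlinarith
  · simpa using hlt

/-- The Johnson graph on `E` is `k * (#E - k)`-connected. -/
theorem connectivity (h : JohnsonSep E k 𝒜 ℬ) (hA : 𝒜.Nonempty) (hB : ℬ.Nonempty) :
    k * (#E - k) ≤ #(johnsonCut E k 𝒜 ℬ) := by
  induction hn : #E generalizing E k 𝒜 ℬ with
  | zero => simp
  | succ n ih =>
    obtain ⟨a, ha⟩ := hA
    obtain ⟨b, hb⟩ := hB
    have h1 := h.sep a ha b hb
    have h2 := card_compl_inter_compl (h.left ha) (h.right hb)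
    have h3 := (mem_powersetCard.1 (h.left ha)).2
    have h4 := (mem_powersetCard.1 (h.right hb)).2
    -- Separation of `a` and `b` forces both `k` and `#E - k` to be at least 2; the pair `x`, `y`
    -- degenerates to one vertex.
    have key := h.bound_of_conn le_rfl one_le_two (by omega) (by omega)
      (fun i hi l 𝒞 𝒟 hs hC hD => ?_) ha ha (by simp) (by simp [h3]) hb hb (by simp)
      (by simp [h4])
    · rw [hn] at key
      simpa using key
    · have hcard : #(E.erase i) = n := by rw [card_erase_of_mem hi, hn]; rfl
      rw [hcard]
      exact ih hs hC hD hcard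

/-- If both families contain an edge of the Johnson graph, the cut is at least as large as the
neighbourhood of an edge. -/
theorem edge_bound (h : JohnsonSep E k 𝒜 ℬ) (hk : 3 ≤ k) (hm : 3 ≤ #E - k)
    {x y : Finset α} (hx : x ∈ 𝒜) (hy : y ∈ 𝒜) (hxy : #(x ∩ y) + 1 = k)
    {x' y' : Finset α} (hx' : x' ∈ ℬ) (hy' : y' ∈ ℬ) (hxy' : #(x' ∩ y') + 1 = k) :
    2 * k * (#E - k) ≤ #(johnsonCut E k 𝒜 ℬ) + #E := by
  have hne : ∀ a ∈ powersetCard k E, ∀ b, #(a ∩ b) + 1 = k → a ≠ b := by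
    rintro a ha _ hab rfl
    rw [inter_self, (mem_powersetCard.1 ha).2] at hab
    omega
  simpa using h.bound_of_conn one_le_two le_rfl hk hm
    (fun i hi l 𝒞 𝒟 hs hC hD => hs.connectivity hC hD) hx hy
    (card_pair (hne x (h.left hx) y hxy)) (by omega) hx' hy'
    (card_pair (hne x' (h.right hx') y' hxy')) (by omega)

end JohnsonSep

end

/-! ### Super cuts as families, and their duality -/

/-- Two nonempty separated families of vertices of the Johnson graph on `E`, neither of which has a
member isolated within its family. -/
structure JohnsonSuperSep {α : Type*} [DecidableEq α] (E : Finset α) (k : ℕ)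
    (𝒜 ℬ : Finset (Finset α)) : Prop extends JohnsonSep E k 𝒜 ℬ where
  left_nonempty : 𝒜.Nonempty
  right_nonempty : ℬ.Nonempty
  left_adj : ∀ a ∈ 𝒜, ∃ b ∈ 𝒜, #(a ∩ b) + 1 = k
  right_adj : ∀ a ∈ ℬ, ∃ b ∈ ℬ, #(a ∩ b) + 1 = k

/-- The sizes of the super vertex-cuts of the Johnson graph on `E`. -/
def superCutSizes {α : Type*} [DecidableEq α] (E : Finset α) (k : ℕ) : Set ℕ :=
  {s | ∃ 𝒜 ℬ, JohnsonSuperSep E k 𝒜 ℬ ∧ #(johnsonCut E k 𝒜 ℬ) = s}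

section

variable {α : Type*} [DecidableEq α] {E : Finset α} {k : ℕ} {𝒜 ℬ : Finset (Finset α)}

theorem JohnsonSuperSep.compl (h : JohnsonSuperSep E k 𝒜 ℬ) :
    JohnsonSuperSep E (#E - k) (𝒜.image (E \ ·)) (ℬ.image (E \ ·)) where
  toJohnsonSep := h.toJohnsonSep.compl
  left_nonempty := h.left_nonempty.image _
  right_nonempty := h.right_nonempty.image _
  left_adj := by
    rw [forall_mem_image]
    intro a ha
    obtain ⟨b, hb, hab⟩ := h.left_adj a ha
    have := card_compl_inter_compl (h.left ha) (h.left hb)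
    exact ⟨E \ b, mem_image_of_mem _ hb, by omega⟩
  right_adj := by
    rw [forall_mem_image]
    intro a ha
    obtain ⟨b, hb, hab⟩ := h.right_adj a ha
    have := card_compl_inter_compl (h.right ha) (h.right hb)
    exact ⟨E \ b, mem_image_of_mem _ hb, by omega⟩

theorem superCutSizes_subset_compl (hk : k ≤ #E) :
    superCutSizes E k ⊆ superCutSizes E (#E - k) := by
  rintro s ⟨𝒜, ℬ, h, rfl⟩
  exact ⟨_, _, h.compl, h.card_cut_compl hk⟩

theorem superCutSizes_compl (hk : k ≤ #E) : superCutSizes E (#E - k) = superCutSizes E k := by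
  refine Set.Subset.antisymm ?_ (superCutSizes_subset_compl hk)
  simpa only [Nat.sub_sub_self hk] using superCutSizes_subset_compl (E := E) (Nat.sub_le #E k)

theorem superCutSizes_eq_empty_of_le_one (hk : k ≤ 1) : superCutSizes E k = ∅ := by
  refine Set.eq_empty_of_forall_notMem ?_
  rintro s ⟨𝒜, ℬ, h, rfl⟩
  obtain ⟨a, ha⟩ := h.left_nonempty
  obtain ⟨b, hb⟩ := h.right_nonempty
  have := h.sep a ha b hb
  omega

/-! ### Pairs -/

theorem JohnsonSuperSep.pair_bound (h : JohnsonSuperSep E 2 𝒜 ℬ) :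
    6 ≤ #E ∧ 3 * (#E - 3) ≤ #(johnsonCut E 2 𝒜 ℬ) := by
  set P := 𝒜.biUnion id with hP
  have hPE : P ⊆ E := biUnion_subset.2 fun a ha => (mem_powersetCard.1 (h.left ha)).1
  have hPB : ∀ b ∈ ℬ, ∀ i ∈ b, i ∉ P := by
    intro b hb i hib hiP
    obtain ⟨a, ha, hia⟩ := mem_biUnion.1 hiP
    have h1 := h.sep a ha b hb
    have h2 : 0 < #(a ∩ b) := card_pos.2 ⟨i, mem_inter.2 ⟨hia, hib⟩⟩
    omega
  have h3 : 3 ≤ #P := by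
    obtain ⟨a, ha⟩ := h.left_nonempty
    obtain ⟨b, hb, hab⟩ := h.left_adj a ha
    have h1 := card_le_card (union_subset (subset_biUnion_of_mem id ha)
      (subset_biUnion_of_mem id hb))
    have h2 := card_union_add_card_inter a b
    have h3 := (mem_powersetCard.1 (h.left ha)).2
    have h4 := (mem_powersetCard.1 (h.left hb)).2
    simp only [id_eq, ← hP] at h1
    omega
  have h3' : 3 ≤ #(E \ P) := by
    obtain ⟨a, ha⟩ := h.right_nonempty
    obtain ⟨b, hb, hab⟩ := h.right_adj a ha
    have hsub : ∀ c ∈ ℬ, c ⊆ E \ P := fun c hc i hi =>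
      mem_sdiff.2 ⟨(mem_powersetCard.1 (h.right hc)).1 hi, hPB c hc i hi⟩
    have h1 := card_le_card (union_subset (hsub a ha) (hsub b hb))
    have h2 := card_union_add_card_inter a b
    have h3 := (mem_powersetCard.1 (h.right ha)).2
    have h4 := (mem_powersetCard.1 (h.right hb)).2
    omega
  have hadd := card_sdiff_add_card_eq_card hPE
  have hle : #(P ×ˢ (E \ P)) ≤ #(johnsonCut E 2 𝒜 ℬ) := by
    refine card_le_card_of_injOn (fun p => {p.1, p.2}) ?_ ?_
    · rintro ⟨i, j⟩ hp
      simp only [coe_product, Set.mem_prod, mem_coe, mem_sdiff] at hp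
      simp only [johnsonCut, mem_coe, mem_sdiff, mem_powersetCard, mem_union]
      refine ⟨⟨?_, card_pair ?_⟩, ?_⟩
      · rw [insert_subset_iff, singleton_subset_iff]
        exact ⟨hPE hp.1, hp.2.1⟩
      · rintro rfl
        exact hp.2.2 hp.1
      · rintro (hA | hB)
        · exact hp.2.2 (mem_biUnion.2 ⟨_, hA, by simp⟩)
        · exact hPB _ hB i (by simp) hp.1
    · rintro ⟨i, j⟩ hp ⟨i', j'⟩ hp' heq
      simp only [coe_product, Set.mem_prod, mem_coe, mem_sdiff] at hp hp'
      simp only [Finset.ext_iff, mem_insert, mem_singleton] at heq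
      have h1 := heq i
      have h2 := heq j
      grind
  rw [card_product] at hle
  refine ⟨by omega, hle.trans' ?_⟩
  -- The excess of `(p + 3) * (q + 3)` over `3 * (p + q + 3)` is `p * q`.
  obtain ⟨p, hp⟩ : ∃ p, #P = p + 3 := ⟨#P - 3, by omega⟩
  obtain ⟨q, hq⟩ : ∃ q, #(E \ P) = q + 3 := ⟨#(E \ P) - 3, by omega⟩
  rw [← hadd, hp, hq, show q + 3 + (p + 3) - 3 = q + p + 3 by omega]
  nlinarith

theorem exists_adj_of_card_lt {T a : Finset α} (ha : a ∈ powersetCard k T) (hk : 1 ≤ k)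
    (hT : k < #T) : ∃ b ∈ powersetCard k T, #(a ∩ b) + 1 = k := by
  have hac := mem_powersetCard.1 ha
  obtain ⟨u, hu⟩ : a.Nonempty := card_pos.1 (by omega)
  obtain ⟨w, hw⟩ : (T \ a).Nonempty := card_pos.1 (by
    rw [card_sdiff_of_subset hac.1]; omega)
  obtain ⟨h1, h2⟩ := swap_spec ha hu hw
  exact ⟨_, h1, by rwa [inter_comm]⟩

/-- The extremal cut consists of the pairs joining a 3-set to its complement. -/
theorem triangle_mem_superCutSizes (hE : 6 ≤ #E) : 3 * (#E - 3) ∈ superCutSizes E 2 := by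
  obtain ⟨T, hTE, hT⟩ := exists_subset_card_eq (show 3 ≤ #E by omega)
  have hT' : #(E \ T) = #E - 3 := by rw [card_sdiff_of_subset hTE, hT]
  have h : JohnsonSuperSep E 2 (powersetCard 2 T) (powersetCard 2 (E \ T)) :=
    { left := powersetCard_mono hTE
      right := powersetCard_mono sdiff_subset
      sep := by
        intro a ha b hb
        have h1 : Disjoint a b := disjoint_sdiff.mono (mem_powersetCard.1 ha).1
          (mem_powersetCard.1 hb).1
        rw [disjoint_iff_inter_eq_empty.1 h1, card_empty]
      left_nonempty := powersetCard_nonempty.2 (by omega)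
      right_nonempty := powersetCard_nonempty.2 (by omega)
      left_adj := fun a ha => exists_adj_of_card_lt ha one_le_two (by omega)
      right_adj := fun a ha => exists_adj_of_card_lt ha one_le_two (by omega) }
  refine ⟨_, _, h, ?_⟩
  have hc := h.card_cut
  rw [card_powersetCard, card_powersetCard, hT, hT'] at hc
  obtain ⟨m, hm⟩ : ∃ m, #E = m + 3 := ⟨#E - 3, by omega⟩
  rw [hm, Nat.add_sub_cancel] at hc
  rw [hm, Nat.add_sub_cancel]
  simp only [Nat.choose_succ_succ' (m + 2) 1, Nat.choose_succ_succ' (m + 1) 1,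
    Nat.choose_succ_succ' m 1, Nat.choose_one_right, show Nat.choose 3 2 = 3 from rfl,
    Nat.reduceAdd] at hc
  omega

/-! ### The neighbourhood of an edge -/

theorem edge_mem_superCutSizes (hk : 3 ≤ k) (hm : k + 3 ≤ #E) :
    2 * k * (#E - k) - #E ∈ superCutSizes E k := by
  obtain ⟨x, hx⟩ := powersetCard_nonempty.2 (show k ≤ #E by omega)
  obtain ⟨y, hy, hxy⟩ := exists_adj_of_card_lt hx (by omega) (by omega)
  have hxc := mem_powersetCard.1 hx
  have hyc := mem_powersetCard.1 hy
  have hunion := card_union_add_card_inter x y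
  have hxyE : x ∪ y ⊆ E := union_subset hxc.1 hyc.1
  have hout : #(E \ (x ∪ y)) + (k + 1) = #E := by
    rw [← card_sdiff_add_card_eq_card hxyE]; omega
  set ℬ := powersetCard k E \ ({x, y} ∪ johnsonNbrs E k x y) with hB
  have hsub : ({x, y} : Finset (Finset α)) ⊆ powersetCard k E := by
    rw [insert_subset_iff, singleton_subset_iff]; exact ⟨hx, hy⟩
  have hNsub : johnsonNbrs E k x y ⊆ powersetCard k E := filter_subset _ _
  have hle : ∀ {a b : Finset α}, a ∈ powersetCard k E → b ∈ powersetCard k E → a ≠ b →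
      #(a ∩ b) + 1 ≤ k := by
    intro a b ha hb hab
    by_contra! hcon
    have h1 := (mem_powersetCard.1 ha).2
    have h2 := (mem_powersetCard.1 hb).2
    exact hab ((eq_of_subset_of_card_le inter_subset_left (by omega)).symm.trans
      (eq_of_subset_of_card_le (inter_subset_right (s₁ := a) (s₂ := b)) (by omega)))
  have hfar : ∀ z, z ∈ ℬ ↔ z ∈ powersetCard k E ∧ #(z ∩ x) + 2 ≤ k ∧ #(z ∩ y) + 2 ≤ k := by
    intro z
    simp only [hB, mem_sdiff, mem_union, mem_insert, mem_singleton, mem_johnsonNbrs]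
    constructor
    · rintro ⟨hz, hz'⟩
      push Not at hz'
      obtain ⟨⟨hzx, hzy⟩, h3⟩ := hz'
      have h1 := hle hz hx hzx
      have h2 := hle hz hy hzy
      have := h3 hz hzx hzy
      exact ⟨hz, by omega, by omega⟩
    · rintro ⟨hz, h1, h2⟩
      refine ⟨hz, ?_⟩
      rintro ((rfl | rfl) | ⟨-, -, -, h3⟩)
      · rw [inter_self] at h1; omega
      · rw [inter_self] at h2; omega
      · omega
  have hfar' : ∀ z ∈ powersetCard k E, 2 ≤ #(z \ (x ∪ y)) → z ∈ ℬ := by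
    intro z hz h2
    refine (hfar z).2 ⟨hz, ?_⟩
    have h1 := (mem_powersetCard.1 hz).2
    have h3 := card_sdiff_add_card_inter z (x ∪ y)
    have h4 := card_le_card (show z ∩ x ⊆ z ∩ (x ∪ y) from
      inter_subset_inter_left subset_union_left)
    have h5 := card_le_card (show z ∩ y ⊆ z ∩ (x ∪ y) from
      inter_subset_inter_left subset_union_right)
    omega
  have h : JohnsonSuperSep E k {x, y} ℬ :=
    { left := hsub
      right := sdiff_subset
      sep := by
        intro a ha b hb
        rw [inter_comm]
        rw [mem_insert, mem_singleton] at ha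
        obtain ⟨-, h1, h2⟩ := (hfar b).1 hb
        rcases ha with rfl | rfl
        · exact h1
        · exact h2
      left_nonempty := ⟨x, by simp⟩
      right_nonempty := by
        obtain ⟨F, hF, hF2⟩ := exists_subset_card_eq (show 2 ≤ #(E \ (x ∪ y)) by omega)
        obtain ⟨z, hFz, hzE, hzc⟩ := exists_subsuperset_card_eq (hF.trans sdiff_subset)
          (show #F ≤ k by omega) (show k ≤ #E by omega)
        refine ⟨z, hfar' z (mem_powersetCard.2 ⟨hzE, hzc⟩) ?_⟩
        rw [← hF2]
        exact card_le_card fun i hi => mem_sdiff.2 ⟨hFz hi, (mem_sdiff.1 (hF hi)).2⟩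
      left_adj := by
        intro a ha
        rw [mem_insert, mem_singleton] at ha
        rcases ha with rfl | rfl
        · exact ⟨y, by simp, hxy⟩
        · exact ⟨x, by simp, by rwa [inter_comm]⟩
      right_adj := by
        intro v hv
        obtain ⟨hvE, hvx, hvy⟩ := (hfar v).1 hv
        have hvc := mem_powersetCard.1 hvE
        -- A neighbour of `v` that is still far from `x` and `y`: exchanging any element for such an
        -- `f` cannot enlarge either intersection. Without such an `f`, `v` contains all of `E \ (x
        -- ∪ y)`, at least two points, and a swap preserving two points outside `x ∪ y` works.
        by_cases hf : ∃ f ∈ E, f ∉ v ∪ (x ∪ y)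
        · obtain ⟨f, hfE, hf⟩ := hf
          simp only [mem_union, not_or] at hf
          obtain ⟨e, he⟩ : v.Nonempty := card_pos.1 (by omega)
          obtain ⟨h1, h2⟩ := swap_spec hvE he (mem_sdiff.2 ⟨hfE, hf.1⟩)
          refine ⟨_, (hfar _).2 ⟨h1, ?_, ?_⟩, by rwa [inter_comm]⟩
          · rw [insert_inter_of_notMem hf.2.1]
            exact (Nat.add_le_add_right (card_le_card
              (inter_subset_inter_right (erase_subset _ _))) 2).trans hvx
          · rw [insert_inter_of_notMem hf.2.2]
            exact (Nat.add_le_add_right (card_le_card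
              (inter_subset_inter_right (erase_subset _ _))) 2).trans hvy
        · push Not at hf
          have h2 : 2 ≤ #(v \ (x ∪ y)) := by
            have := card_le_card (show E \ (x ∪ y) ⊆ v \ (x ∪ y) by
              intro i hi
              rw [mem_sdiff] at hi ⊢
              exact ⟨(mem_union.1 (hf i hi.1)).resolve_right hi.2, hi.2⟩)
            omega
          obtain ⟨e, he, he2⟩ : ∃ e ∈ v, 2 ≤ #(v.erase e \ (x ∪ y)) := by
            by_cases hd : ∃ e ∈ v, e ∈ x ∪ y
            · obtain ⟨e, he, hexy⟩ := hd
              refine ⟨e, he, ?_⟩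
              have : v.erase e \ (x ∪ y) = v \ (x ∪ y) := by
                ext i
                simp only [mem_sdiff, mem_erase]
                grind
              rwa [this]
            -- Now `v` misses `x ∪ y`, so `k ≥ 3` leaves two outside points after removing any
            -- element.
            · push Not at hd
              obtain ⟨e, he⟩ : v.Nonempty := card_pos.1 (by omega)
              refine ⟨e, he, ?_⟩
              have : v.erase e \ (x ∪ y) = v.erase e :=
                sdiff_eq_self_of_disjoint
                  (disjoint_left.2 fun i hi => hd i (mem_of_mem_erase hi))
              rw [this, card_erase_of_mem he]
              omega
          obtain ⟨f, hf⟩ : (E \ v).Nonempty := card_pos.1 (by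
            rw [card_sdiff_of_subset hvc.1]; omega)
          obtain ⟨h3, h4⟩ := swap_spec hvE he hf
          refine ⟨_, hfar' _ h3 (he2.trans (card_le_card ?_)), by rwa [inter_comm]⟩
          exact sdiff_subset_sdiff (subset_insert _ _) le_rfl }
  refine ⟨_, _, h, ?_⟩
  have hcut : johnsonCut E k {x, y} ℬ = johnsonNbrs E k x y := by
    ext z
    have h1 : z ∈ johnsonNbrs E k x y → z ∈ powersetCard k E := fun hz => hNsub hz
    have h2 : z ∈ johnsonNbrs E k x y → z ≠ x ∧ z ≠ y := fun hz =>
      ⟨(mem_johnsonNbrs.1 hz).2.1, (mem_johnsonNbrs.1 hz).2.2.1⟩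
    simp only [johnsonCut, hB, mem_sdiff, mem_union, mem_insert, mem_singleton]
    tauto
  have hN := card_johnsonNbrs_of_adj hx hy (by rwa [inter_comm])
  rw [hcut]
  omega

theorem JohnsonSuperSep.edge_bound (h : JohnsonSuperSep E k 𝒜 ℬ) (hk : 3 ≤ k)
    (hm : k + 3 ≤ #E) : 2 * k * (#E - k) - #E ≤ #(johnsonCut E k 𝒜 ℬ) := by
  obtain ⟨x, hx⟩ := h.left_nonempty
  obtain ⟨y, hy, hxy⟩ := h.left_adj x hx
  obtain ⟨x', hx'⟩ := h.right_nonempty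
  obtain ⟨y', hy', hxy'⟩ := h.right_adj x' hx'
  have := h.toJohnsonSep.edge_bound hk (by omega) hx hy hxy hx' hy' hxy'
  omega

end

/-! ### Super vertex-cuts as separated families -/

section

variable {n k : ℕ}

theorem exists_superSep_of_isSuperVertexCut {S : Set {s : Finset (Fin n) // #s = k}}
    (hS : (johnsonGraph n k).IsSuperVertexCut S) :
    ∃ s ∈ superCutSizes (univ : Finset (Fin n)) k, S.encard = s := by
  classical
  obtain ⟨hcut, hiso⟩ := hS
  have hdis := hcut.resolve_right (by rintro ⟨v, hv⟩; exact hiso v hv)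
  simp only [SimpleGraph.Preconnected, not_forall] at hdis
  obtain ⟨u, v, huv⟩ := hdis
  set H := (johnsonGraph n k).induce Sᶜ with hH
  have hmem : ∀ w : {s : Finset (Fin n) // #s = k}, w.1 ∈ powersetCard k univ := fun w =>
    mem_powersetCard.2 ⟨subset_univ _, w.2⟩
  have hnbr : ∀ w, ∃ w', H.Adj w w' := by
    intro w
    by_contra! hcon
    exact hiso w hcon
  set f : ↥Sᶜ → Finset (Fin n) := fun w => w.1.1 with hf
  have hfinj : Function.Injective f := fun a b hab => Subtype.ext (Subtype.ext hab)
  -- One component against the union of all others, so the two families exhaust the surviving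
  -- vertices.
  set 𝒜 := (univ.filter (fun w => H.Reachable u w)).image f with hA
  set ℬ := (univ.filter (fun w => ¬ H.Reachable u w)).image f with hB
  have hsep : JohnsonSuperSep (univ : Finset (Fin n)) k 𝒜 ℬ :=
    { left := image_subset_iff.2 fun w _ => hmem w.1
      right := image_subset_iff.2 fun w _ => hmem w.1
      sep := by
        simp only [hA, hB, forall_mem_image, mem_filter, mem_univ, true_and]
        intro a ha b hb
        have hne : ¬ H.Adj a b := fun hab => hb (ha.trans hab.reachable)
        have hne' : #(a.1.1 ∩ b.1.1) + 1 ≠ k := hne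
        have h1 := card_le_card (inter_subset_left (s₁ := a.1.1) (s₂ := b.1.1))
        have h2 := a.1.2
        have h3 := b.1.2
        have hne2 : #(a.1.1 ∩ b.1.1) ≠ k := by
          intro hcon
          have e1 : a.1.1 ∩ b.1.1 = a.1.1 :=
            eq_of_subset_of_card_le inter_subset_left (by omega)
          have e2 : a.1.1 ∩ b.1.1 = b.1.1 :=
            eq_of_subset_of_card_le inter_subset_right (by omega)
          have : a = b := hfinj (e1.symm.trans e2)
          exact hb (this ▸ ha)
        simp only [hf]
        omega
      left_nonempty := ⟨f u, mem_image_of_mem _ (by simp)⟩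
      right_nonempty := ⟨f v, mem_image_of_mem _ (by simpa using huv)⟩
      left_adj := by
        simp only [hA, forall_mem_image, mem_filter, mem_univ, true_and]
        intro a ha
        obtain ⟨b, hab⟩ := hnbr a
        exact ⟨f b, mem_image_of_mem _ (by simpa using ha.trans hab.reachable), hab⟩
      right_adj := by
        simp only [hB, forall_mem_image, mem_filter, mem_univ, true_and]
        intro a ha
        obtain ⟨b, hab⟩ := hnbr a
        refine ⟨f b, mem_image_of_mem _ ?_, hab⟩
        simp only [mem_filter, mem_univ, true_and]
        exact fun hb => ha (hb.trans hab.symm.reachable) }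
  refine ⟨_, ⟨_, _, hsep, rfl⟩, ?_⟩
  rw [← Subtype.val_injective.encard_image, ← Set.encard_coe_eq_coe_finsetCard]
  congr 1
  ext z
  simp only [Set.mem_image, johnsonCut, hA, hB, hf, mem_coe, mem_sdiff, mem_union, mem_image,
    mem_filter, mem_univ, true_and, mem_powersetCard, subset_univ, Subtype.exists,
    Set.mem_compl_iff]
  constructor
  · rintro ⟨w, hw, hwS, rfl⟩
    refine ⟨hw, ?_⟩
    rintro (⟨a, ha, haS, -, rfl⟩ | ⟨a, ha, haS, -, rfl⟩) <;> exact haS hwS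
  · rintro ⟨hz, hzn⟩
    refine ⟨z, hz, ?_, rfl⟩
    by_contra hzS
    refine hzn ?_
    by_cases hr : H.Reachable u ⟨⟨z, hz⟩, hzS⟩
    · exact Or.inl ⟨z, hz, hzS, hr, rfl⟩
    · exact Or.inr ⟨z, hz, hzS, hr, rfl⟩

theorem exists_isSuperVertexCut_of_mem {s : ℕ}
    (hs : s ∈ superCutSizes (univ : Finset (Fin n)) k) :
    ∃ S, (johnsonGraph n k).IsSuperVertexCut S ∧ S.encard = s := by
  obtain ⟨𝒜, ℬ, h, rfl⟩ := hs
  have hAc : ∀ a ∈ 𝒜, #a = k := fun a ha => (mem_powersetCard.1 (h.left ha)).2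
  have hBc : ∀ a ∈ ℬ, #a = k := fun a ha => (mem_powersetCard.1 (h.right ha)).2
  set S : Set {s : Finset (Fin n) // #s = k} := {v | v.1 ∉ 𝒜 ∪ ℬ} with hS
  have hSc : ∀ v : {s : Finset (Fin n) // #s = k}, v ∈ Sᶜ ↔ v.1 ∈ 𝒜 ∨ v.1 ∈ ℬ := by
    intro v
    rw [Set.mem_compl_iff, hS, Set.mem_ofPred_eq, not_not, mem_union]
  refine ⟨S, ⟨Or.inl ?_, ?_⟩, ?_⟩
  · intro hpre
    obtain ⟨a, ha⟩ := h.left_nonempty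
    obtain ⟨b, hb⟩ := h.right_nonempty
    have hclosed : ∀ v w : ↥Sᶜ, ((johnsonGraph n k).induce Sᶜ).Walk v w →
        v.1.1 ∈ 𝒜 → w.1.1 ∈ 𝒜 := by
      intro v w p
      induction p with
      | nil => exact id
      | @cons v w' w hadj _ ih =>
        intro hv
        refine ih (((hSc w'.1).1 w'.2).resolve_right fun hw => ?_)
        have h1 := h.sep _ hv _ hw
        have h2 : #(v.1.1 ∩ w'.1.1) + 1 = k := hadj
        omega
    obtain ⟨p⟩ := hpre ⟨⟨a, hAc a ha⟩, (hSc _).2 (Or.inl ha)⟩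
      ⟨⟨b, hBc b hb⟩, (hSc _).2 (Or.inr hb)⟩
    exact disjoint_left.1 h.disjoint (hclosed _ _ p ha) hb
  · rintro ⟨⟨v, hvc⟩, hv⟩ hiso
    rcases (hSc _).1 hv with hvA | hvB
    · obtain ⟨b, hb, hab⟩ := h.left_adj v hvA
      exact hiso (⟨⟨b, hAc b hb⟩, (hSc _).2 (Or.inl hb)⟩ : ↥Sᶜ) hab
    · obtain ⟨b, hb, hab⟩ := h.right_adj v hvB
      exact hiso (⟨⟨b, hBc b hb⟩, (hSc _).2 (Or.inr hb)⟩ : ↥Sᶜ) hab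
  · rw [← Subtype.val_injective.encard_image, ← Set.encard_coe_eq_coe_finsetCard]
    congr 1
    ext z
    simp [johnsonCut, hS, mem_powersetCard, and_comm, and_left_comm]

theorem superConnectivity_johnsonGraph_of_isLeast {s : ℕ}
    (hs : IsLeast (superCutSizes (univ : Finset (Fin n)) k) s) :
    (johnsonGraph n k).superConnectivity = s := by
  refine le_antisymm ?_ ?_
  · obtain ⟨S, hS, hc⟩ := exists_isSuperVertexCut_of_mem hs.1
    rw [← hc]
    exact iInf₂_le S hS
  · refine le_iInf₂ fun S hS => ?_
    obtain ⟨t, ht, hc⟩ := exists_superSep_of_isSuperVertexCut hS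
    rw [hc]
    exact_mod_cast hs.2 ht

theorem superConnectivity_johnsonGraph_of_eq_empty
    (hs : superCutSizes (univ : Finset (Fin n)) k = ∅) :
    (johnsonGraph n k).superConnectivity = ⊤ := by
  refine top_le_iff.1 (le_iInf₂ fun S hS => ?_)
  obtain ⟨t, ht, -⟩ := exists_superSep_of_isSuperVertexCut hS
  rw [hs] at ht
  exact ht.elim

end

/-! ### The case analysis -/

theorem isLeast_superCutSizes_two {α : Type*} [DecidableEq α] {E : Finset α} (hE : 6 ≤ #E) :
    IsLeast (superCutSizes E 2) (3 * (#E - 3)) := by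
  refine ⟨triangle_mem_superCutSizes hE, ?_⟩
  rintro s ⟨𝒜, ℬ, h, rfl⟩
  exact h.pair_bound.2

theorem superCutSizes_two_eq_empty {α : Type*} [DecidableEq α] {E : Finset α} (hE : #E < 6) :
    superCutSizes E 2 = ∅ := by
  refine Set.eq_empty_of_forall_notMem ?_
  rintro s ⟨𝒜, ℬ, h, rfl⟩
  exact absurd h.pair_bound.1 (by omega)

theorem proposition11 (n k : ℕ) (hk : 1 ≤ k) (hkn : k ≤ n) :
    (johnsonGraph n k).superConnectivity =
      if k = 2 ∧ 6 ≤ n then ((3 * (n - 3) : ℕ) : ℕ∞)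
      else if 4 ≤ k ∧ n = k + 2 then ((3 * (k - 1) : ℕ) : ℕ∞)
      else if 3 ≤ k ∧ k + 3 ≤ n then (((2 * k - 1) * (n - k) - k : ℕ) : ℕ∞)
      else ⊤ := by
  have hcard : #(univ : Finset (Fin n)) = n := by simp
  have hdual : superCutSizes (univ : Finset (Fin n))
      (n - k) = superCutSizes (univ : Finset (Fin n)) k := by
    have := superCutSizes_compl (show k ≤ #(univ : Finset (Fin n)) by omega)
    rwa [hcard] at this
  split_ifs with h1 h2 h3
  · obtain ⟨rfl, hn⟩ := h1
    refine superConnectivity_johnsonGraph_of_isLeast ?_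
    have := isLeast_superCutSizes_two (show 6 ≤ #(univ : Finset (Fin n)) by omega)
    rwa [hcard] at this
  · obtain ⟨hk4, hn⟩ := h2
    refine superConnectivity_johnsonGraph_of_isLeast ?_
    rw [← hdual, show n - k = 2 by omega, show k - 1 = n - 3 by omega]
    have := isLeast_superCutSizes_two (show 6 ≤ #(univ : Finset (Fin n)) by omega)
    rwa [hcard] at this
  · obtain ⟨hk3, hn⟩ := h3
    refine superConnectivity_johnsonGraph_of_isLeast ?_
    have hval : (2 * k - 1) * (n - k) - k = 2 * k * (n - k) - n := by
      rw [Nat.sub_mul, one_mul, Nat.sub_sub, Nat.sub_add_cancel hkn]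
    have hn' : k + 3 ≤ #(univ : Finset (Fin n)) := by omega
    rw [hval]
    refine ⟨?_, ?_⟩
    · have := edge_mem_superCutSizes hk3 hn'
      rwa [hcard] at this
    · rintro s ⟨𝒜, ℬ, h, rfl⟩
      have := h.edge_bound hk3 hn'
      rwa [hcard] at this
  · refine superConnectivity_johnsonGraph_of_eq_empty ?_
    by_cases hk1 : k ≤ 1
    · exact superCutSizes_eq_empty_of_le_one hk1
    by_cases hk2 : k = 2
    · subst hk2
      exact superCutSizes_two_eq_empty (by rw [hcard]; omega)
    rw [← hdual]
    by_cases hm1 : n - k ≤ 1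
    · exact superCutSizes_eq_empty_of_le_one hm1
    -- Only `k = 3`, `n = 5` remains, dual to pairs in a 5-set.
    rw [show n - k = 2 by omega]
    exact superCutSizes_two_eq_empty (by rw [hcard]; omega)
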